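/- Let $N=\mathbb{Z}^n$ with $n\ge 1$, let $M=\operatorname{Hom}(N,\mathbb{Z})$, and let $\Delta^*$ be a complete simplicial augmented fan in $N$: a finite complete simplicial fan $\Delta$ of strongly convex rational polyhedral cones in $N_{\mathbb{R}}$ together with a nonzero lattice point $n(\rho)\in N\cap\rho$ for every one-dimensional cone $\rho\in\Delta(1)$. Let $X=X_{\Delta^*}$ be the associated compact toric orbifold. Its underlying space is the toric variety $X_\Delta=\bigcup_{\sigma\in\Delta}\operatorname{Spec}\mathbb{C}[\sigma^\vee\cap M]$. Its uniformizing charts are, for the $n$-dimensional cones $\sigma\in\Delta$ with rays $\rho_1,\dots,\rho_n$ and $p_i=n(\rho_i)$, the maps $\mathbb{C}^n\to U_\sigma=\operatorname{Spec}\mathbb{C}[\sigma^\vee\cap M]$ sending $z$ to the point with $x^m=\prod_i z_i^{\langle m,p_i\rangle}$; they have the local uniformizing groups $N/\mathbb{Z}\{p_1,\dots,p_n\}$. Assume that $X$ is Fano, i.e. if $k:N_{\mathbb{R}}\to\mathbb{R}$ is the function that is linear on each cone of $\Delta$ with $k(n(\rho))=1$ for all $\rho\in\Delta(1)$, then $-k$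 is strictly upper convex: $-k$ is superadditive, and it is given by different linear functions on different $n$-dimensional cones. Assume also that $X$ is special symmetric, i.e. the group $\mathcal{W}_0(X)$ of all $\gamma\in GL(n,\mathbb{Z})$ that permute the cones of $\Delta$ and satisfy $n(\gamma\rho)=\gamma\,n(\rho)$ for all $\rho\in\Delta(1)$ contains the involution $n\mapsto -n$. Let $\mathbf{K}_X$ be the (orbifold) canonical V-bundle of $X$, i.e. the V-bundle of holomorphic $n$-forms. Then there is a largest positive integer $m$ for which there exists a (proper) holomorphic line V-bundle $\mathbf{L}$ on $X$ with $\mathbf{L}^m\cong\mathbf{K}_X^{-1}$, and this integer, the index $\operatorname{Ind}(X)$, is $1$ or $2$. -/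

import Mathlib

open Set Filter Topology Matrix

/-! ### Complex orbifolds given by uniformizing charts, and holomorphic line V-bundles

An (effective) complex orbifold of dimension `n` is given by a family of uniformizing maps
`φ i : ℂⁿ → X` onto pieces of the underlying space `X`.  Its changes of charts (Satake's
"injections") are the biholomorphic maps between open subsets of `ℂⁿ` that lie over the identity
of `X`; for `i = j` they include the elements of the local uniformizing groups. -/

/-- A change of charts from the uniformizing chart `φ i` to the uniformizing chart `φ j`: a
biholomorphic map between open subsets of `ℂⁿ` that commutes with the projections to `X`. -/
structure ChartChange {n : ℕ} {X ι : Type} (φ : ι → (Fin n → ℂ) → X) (i j : ι) where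
  toHomeo : OpenPartialHomeomorph (Fin n → ℂ) (Fin n → ℂ)
  holo : AnalyticOnNhd ℂ toHomeo toHomeo.source
  holo_symm : AnalyticOnNhd ℂ toHomeo.symm toHomeo.target
  proj_eq : ∀ x ∈ toHomeo.source, φ j (toHomeo x) = φ i x

/-- Composition of changes of charts, on the largest possible domain. -/
noncomputable def ChartChange.trans {n : ℕ} {X ι : Type} {φ : ι → (Fin n → ℂ) → X} {i j k : ι}
    (e : ChartChange φ i j) (e' : ChartChange φ j k) : ChartChange φ i k where
  toHomeo := e.toHomeo.trans e'.toHomeo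
  holo := by
    intro x hx
    simp only [OpenPartialHomeomorph.trans_source, mem_inter_iff, mem_preimage] at hx
    exact (e'.holo _ hx.2).comp (e.holo x hx.1)
  holo_symm := by
    intro x hx
    simp only [OpenPartialHomeomorph.trans_target, mem_inter_iff, mem_preimage] at hx
    exact (e.holo_symm _ hx.2).comp (e'.holo_symm x hx.1)
  proj_eq := by
    intro x hx
    simp only [OpenPartialHomeomorph.trans_source, mem_inter_iff, mem_preimage] at hx
    exact (e'.proj_eq _ hx.2).trans (e.proj_eq x hx.1)

/-- A (proper) holomorphic line V-bundle on the orbifold with uniformizing charts `φ`, in terms of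
local trivializations: every chart is covered by open sets `dom i a`, over which the bundle is
identified with `dom i a × ℂ`, and every change of charts `e` from `i` to `j` lifts to the bundle,
the lift being `(x, v) ↦ (e x, trans e a b x * v)` in the trivializations over `dom i a` and
`dom j b`.  The lift depends only on the germ of `e`, and lifts are compatible with composition. -/
structure LineVBundle {n : ℕ} {X ι : Type} (φ : ι → (Fin n → ℂ) → X) where
  κ : ι → Type
  dom : ∀ i, κ i → Set (Fin n → ℂ)
  isOpen_dom : ∀ i a, IsOpen (dom i a)
  cover : ∀ i x, ∃ a, x ∈ dom i a
  trans : ∀ {i j}, ChartChange φ i j → κ i → κ j → (Fin n → ℂ) → ℂ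
  holo : ∀ {i j} (e : ChartChange φ i j) (a : κ i) (b : κ j),
    AnalyticOnNhd ℂ (trans e a b)
      {x | x ∈ dom i a ∧ x ∈ e.toHomeo.source ∧ e.toHomeo x ∈ dom j b}
  ne_zero : ∀ {i j} (e : ChartChange φ i j) (a : κ i) (b : κ j) (x : Fin n → ℂ),
    x ∈ dom i a → x ∈ e.toHomeo.source → e.toHomeo x ∈ dom j b → trans e a b x ≠ 0
  germ : ∀ {i j} (e e' : ChartChange φ i j) (a : κ i) (b : κ j) (x : Fin n → ℂ),
    x ∈ dom i a → x ∈ e.toHomeo.source → x ∈ e'.toHomeo.source → e.toHomeo x ∈ dom j b →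
    (e.toHomeo : (Fin n → ℂ) → (Fin n → ℂ)) =ᶠ[𝓝 x] e'.toHomeo →
    trans e a b x = trans e' a b x
  cocycle : ∀ {i j k} (e : ChartChange φ i j) (e' : ChartChange φ j k)
    (a : κ i) (b : κ j) (c : κ k) (x : Fin n → ℂ),
    x ∈ dom i a → x ∈ e.toHomeo.source → e.toHomeo x ∈ dom j b →
    e.toHomeo x ∈ e'.toHomeo.source → e'.toHomeo (e.toHomeo x) ∈ dom k c →
    trans (e.trans e') a c x = trans e' b c (e.toHomeo x) * trans e a b x

namespace LineVBundle

variable {n : ℕ} {X ι : Type} {φ : ι → (Fin n → ℂ) → X}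

/-- Isomorphism of holomorphic line V-bundles: on every chart a bundle isomorphism, given in the
trivializations over `L.dom i a` and `L'.dom i b` by a nowhere vanishing holomorphic function
`u i a b`, that commutes with the lifts of all changes of charts. -/
def Iso (L L' : LineVBundle φ) : Prop :=
  ∃ u : ∀ i, L.κ i → L'.κ i → (Fin n → ℂ) → ℂ,
    (∀ i a b, AnalyticOnNhd ℂ (u i a b) (L.dom i a ∩ L'.dom i b)) ∧
    (∀ i a b, ∀ x ∈ L.dom i a ∩ L'.dom i b, u i a b x ≠ 0) ∧
    ∀ (i j : ι) (e : ChartChange φ i j) (a : L.κ i) (b : L.κ j) (a' : L'.κ i) (b' : L'.κ j),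
      ∀ x ∈ e.toHomeo.source, x ∈ L.dom i a → x ∈ L'.dom i a' →
        e.toHomeo x ∈ L.dom j b → e.toHomeo x ∈ L'.dom j b' →
        u j b b' (e.toHomeo x) * L.trans e a b x = L'.trans e a' b' x * u i a a' x

/-- The tensor power `L^m` of a line V-bundle. -/
noncomputable def pow (L : LineVBundle φ) (m : ℕ) : LineVBundle φ where
  κ := L.κ
  dom := L.dom
  isOpen_dom := L.isOpen_dom
  cover := L.cover
  trans e a b x := L.trans e a b x ^ m
  holo e a b := (L.holo e a b).pow m
  ne_zero e a b x h1 h2 h3 := pow_ne_zero m (L.ne_zero e a b x h1 h2 h3)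
  germ e e' a b x h1 h2 h3 h4 h5 := by rw [L.germ e e' a b x h1 h2 h3 h4 h5]
  cocycle e e' a b c x h1 h2 h3 h4 h5 := by
    rw [L.cocycle e e' a b c x h1 h2 h3 h4 h5, mul_pow]

/-- The dual `L⁻¹` of a line V-bundle. -/
noncomputable def dual (L : LineVBundle φ) : LineVBundle φ where
  κ := L.κ
  dom := L.dom
  isOpen_dom := L.isOpen_dom
  cover := L.cover
  trans e a b x := (L.trans e a b x)⁻¹
  holo e a b := (L.holo e a b).inv fun x hx => L.ne_zero e a b x hx.1 hx.2.1 hx.2.2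
  ne_zero e a b x h1 h2 h3 := inv_ne_zero (L.ne_zero e a b x h1 h2 h3)
  germ e e' a b x h1 h2 h3 h4 h5 := by rw [L.germ e e' a b x h1 h2 h3 h4 h5]
  cocycle e e' a b c x h1 h2 h3 h4 h5 := by
    rw [L.cocycle e e' a b c x h1 h2 h3 h4 h5, mul_inv]

theorem analyticOnNhd_det_fderiv (e : (Fin n → ℂ) → (Fin n → ℂ)) (s : Set (Fin n → ℂ))
    (he : AnalyticOnNhd ℂ e s) : AnalyticOnNhd ℂ (fun x => (fderiv ℂ e x).det) s := by
  have h : (fun x => (fderiv ℂ e x).det) =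
      fun x => ∑ σ : Equiv.Perm (Fin n), ((Equiv.Perm.sign σ : ℤ) : ℂ) *
        ∏ i, (fderiv ℂ e x) (Pi.single i 1) (σ i) := by
    funext x
    rw [ContinuousLinearMap.det, ← LinearMap.det_toMatrix', Matrix.det_apply']
    refine Finset.sum_congr rfl fun σ _ => ?_
    simp [LinearMap.toMatrix'_apply]
  rw [h]
  refine Finset.analyticOnNhd_fun_sum _ fun σ _ => ?_
  refine analyticOnNhd_const.mul ?_
  refine Finset.analyticOnNhd_fun_prod _ fun i _ => ?_
  intro x hx
  have h1 := he.fderiv x hx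
  have h2 := ((ContinuousLinearMap.proj (R := ℂ) (φ := fun _ : Fin n => ℂ) (σ i)).comp
    (ContinuousLinearMap.apply ℂ (Fin n → ℂ) (Pi.single i (1 : ℂ) : Fin n → ℂ))).analyticAt
    (fderiv ℂ e x)
  exact h2.comp (f := fun y => fderiv ℂ e y) h1

theorem det_fderiv_ne_zero {i j : ι} (e : ChartChange φ i j) (x : Fin n → ℂ)
    (hx : x ∈ e.toHomeo.source) : (fderiv ℂ e.toHomeo x).det ≠ 0 := by
  have h1 := (e.holo x hx).differentiableAt
  have h2 := (e.holo_symm _ (e.toHomeo.map_source hx)).differentiableAt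
  have h3 : (fun y => e.toHomeo.symm (e.toHomeo y)) =ᶠ[𝓝 x] id :=
    e.toHomeo.eventually_left_inverse hx
  have h4 := h3.fderiv_eq (𝕜 := ℂ)
  have h5 : fderiv ℂ (fun y => e.toHomeo.symm (e.toHomeo y)) x = _ := fderiv_comp x h2 h1
  rw [h5, fderiv_id] at h4
  intro h0
  have h6 := congrArg ContinuousLinearMap.det h4
  simp only [ContinuousLinearMap.det, ContinuousLinearMap.toLinearMap_comp,
    LinearMap.det_comp] at h6 h0
  rw [h0, mul_zero] at h6
  simp at h6

/-- The canonical V-bundle `K`, the V-bundle of holomorphic `n`-forms.  It is trivialized by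
`dz₁ ∧ ⋯ ∧ dzₙ` on every chart; a change of charts `e` carries the form with value
`v dz₁ ∧ ⋯ ∧ dzₙ` at `x` to the form with value `det (De x)⁻¹ v dz₁ ∧ ⋯ ∧ dzₙ` at `e x`. -/
noncomputable def canonical (φ : ι → (Fin n → ℂ) → X) : LineVBundle φ where
  κ _ := Unit
  dom _ _ := univ
  isOpen_dom _ _ := isOpen_univ
  cover _ _ := ⟨(), mem_univ _⟩
  trans e _ _ x := (fderiv ℂ e.toHomeo x).det⁻¹
  holo e a b := by
    refine AnalyticOnNhd.inv ?_ fun x hx => det_fderiv_ne_zero e x hx.2.1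
    exact (analyticOnNhd_det_fderiv _ _ e.holo).mono fun x hx => hx.2.1
  ne_zero e a b x _ hx _ := inv_ne_zero (det_fderiv_ne_zero e x hx)
  germ e e' a b x _ _ _ _ h := by rw [h.fderiv_eq]
  cocycle e e' a b c x _ h1 _ h2 _ := by
    have h : fderiv ℂ (e.trans e').toHomeo x =
        (fderiv ℂ e'.toHomeo (e.toHomeo x)).comp (fderiv ℂ e.toHomeo x) :=
      fderiv_comp x (e'.holo _ h2).differentiableAt (e.holo x h1).differentiableAt
    rw [h, ← mul_inv]
    simp [ContinuousLinearMap.det, LinearMap.det_comp]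

end LineVBundle

/-- The positive integers `m` such that the anti-canonical V-bundle has an `m`-th root, i.e. there
is a holomorphic line V-bundle `L` with `L^m ≅ K⁻¹`. -/
def antiCanonicalRoots {n : ℕ} {X ι : Type} (φ : ι → (Fin n → ℂ) → X) : Set ℕ :=
  {m | 0 < m ∧ ∃ L : LineVBundle φ, (L.pow m).Iso (LineVBundle.canonical φ).dual}

/-- The index: the largest positive integer `m` such that the anti-canonical V-bundle has an
`m`-th root (meaningful if there is a largest one). -/
noncomputable def orbifoldIndex {n : ℕ} {X ι : Type} (φ : ι → (Fin n → ℂ) → X) : ℕ :=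
  sSup (antiCanonicalRoots φ)

/-! ### Fans in the lattice `N = ℤⁿ`, with dual lattice `M = ℤⁿ` under the dot product -/

/-- The inclusion `N = ℤⁿ ⊆ N_ℝ = ℝⁿ`. -/
def latR {n : ℕ} (v : Fin n → ℤ) : Fin n → ℝ := fun i => (v i : ℝ)

/-- Strongly convex rational polyhedral cones in `ℝⁿ`. -/
def IsRationalCone {n : ℕ} (σ : PointedCone ℝ (Fin n → ℝ)) : Prop :=
  (∃ S : Finset (Fin n → ℤ), σ = PointedCone.hull ℝ (latR '' (S : Set (Fin n → ℤ)))) ∧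
    ∀ x ∈ σ, -x ∈ σ → x = 0

/-- `τ` is a face of `σ`: `τ = σ ∩ m^⊥` for some `m` in the dual cone of `σ`. -/
def IsFaceOf {n : ℕ} (τ σ : PointedCone ℝ (Fin n → ℝ)) : Prop :=
  ∃ m : Fin n → ℝ, (∀ y ∈ σ, 0 ≤ m ⬝ᵥ y) ∧ ∀ y, y ∈ τ ↔ y ∈ σ ∧ m ⬝ᵥ y = 0

/-- The dimension of a cone: the dimension of its linear span. -/
noncomputable def coneDim {n : ℕ} (σ : PointedCone ℝ (Fin n → ℝ)) : ℕ :=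
  Module.finrank ℝ (Submodule.span ℝ (σ : Set (Fin n → ℝ)))

/-- A (finite) fan in `N = ℤⁿ`. -/
structure Fan (n : ℕ) where
  cones : Set (PointedCone ℝ (Fin n → ℝ))
  finite : cones.Finite
  rational : ∀ σ ∈ cones, IsRationalCone σ
  face_mem : ∀ σ ∈ cones, ∀ τ, IsFaceOf τ σ → τ ∈ cones
  inter_face : ∀ σ ∈ cones, ∀ τ ∈ cones, IsFaceOf (σ ⊓ τ) σ ∧ IsFaceOf (σ ⊓ τ) τ

/-- An augmented fan `Δ*`: a fan `Δ` together with a nonzero lattice point `n(ρ) = gen ρ` on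
every one-dimensional cone `ρ ∈ Δ(1)`. -/
structure AugmentedFan (n : ℕ) extends Fan n where
  gen : {ρ // ρ ∈ cones ∧ coneDim ρ = 1} → (Fin n → ℤ)
  gen_mem : ∀ ρ, latR (gen ρ) ∈ ρ.1
  gen_ne_zero : ∀ ρ, gen ρ ≠ 0

namespace AugmentedFan

variable {n : ℕ} (Δ : AugmentedFan n)

/-- The set `Δ(1)` of one-dimensional cones. -/
abbrev Ray : Type := {ρ // ρ ∈ Δ.cones ∧ coneDim ρ = 1}

/-- The fan is complete: its support is all of `N_ℝ`. -/
def IsComplete : Prop := ∀ x : Fin n → ℝ, ∃ σ ∈ Δ.cones, x ∈ σ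

/-- The fan is simplicial: every `n`-dimensional cone is generated by `n` linearly independent
lattice points. -/
def IsSimplicial : Prop :=
  ∀ σ ∈ Δ.cones, coneDim σ = n → ∃ p : Fin n → (Fin n → ℤ),
    LinearIndependent ℝ (fun i => latR (p i)) ∧
      σ = PointedCone.hull ℝ (range fun i => latR (p i))

/-! ### The toric variety and its orbifold charts -/

/-- The semigroup `S_σ = σ^∨ ∩ M`. -/
def dualMonoid (σ : PointedCone ℝ (Fin n → ℝ)) : AddSubmonoid (Fin n → ℤ) where
  carrier := {m | ∀ y ∈ σ, 0 ≤ latR m ⬝ᵥ y}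
  zero_mem' := by
    intro y _
    have : latR (0 : Fin n → ℤ) = 0 := by funext i; simp [latR]
    simp [this]
  add_mem' := by
    intro a b ha hb y hy
    have : latR (a + b) = latR a + latR b := by funext i; simp [latR]
    rw [this, add_dotProduct]
    exact add_nonneg (ha y hy) (hb y hy)

/-- The points of the affine toric variety `U_σ = Spec ℂ[S_σ]`: the semigroup homomorphisms from
`S_σ` to the multiplicative semigroup `ℂ`. -/
abbrev AffinePoint (σ : PointedCone ℝ (Fin n → ℝ)) : Type :=
  Multiplicative (dualMonoid σ) →* ℂ

theorem dualMonoid_anti {σ τ : PointedCone ℝ (Fin n → ℝ)} (h : τ ≤ σ) :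
    dualMonoid σ ≤ dualMonoid τ := fun _ hm y hy => hm y (h hy)

/-- The map `U_τ → U_σ` for `τ ⊆ σ`, dual to the inclusion `S_σ ⊆ S_τ`. -/
def affineIncl {σ τ : PointedCone ℝ (Fin n → ℝ)} (h : τ ≤ σ) (x : AffinePoint τ) :
    AffinePoint σ :=
  x.comp (AddMonoidHom.toMultiplicative (AddSubmonoid.inclusion (dualMonoid_anti h)))

/-- The gluing of the affine pieces: points of `U_σ` and of `U_τ` are identified when they come
from the same point of `U_{σ ∩ τ}`. -/
def Glue (p q : Σ σ : Δ.cones, AffinePoint σ.1) : Prop :=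
  ∃ z : AffinePoint (p.1.1 ⊓ q.1.1),
    affineIncl inf_le_left z = p.2 ∧ affineIncl inf_le_right z = q.2

/-- The (points of the) toric variety `X_Δ`, glued from the affine pieces `U_σ`, `σ ∈ Δ`. -/
def ToricVariety : Type := Quot Δ.Glue

/-- The index set of the orbifold charts: an `n`-dimensional cone `σ ∈ Δ(n)` together with an
ordering `ρ 0, …, ρ (n - 1)` of its rays, so that `σ` is the cone generated by the linearly
independent lattice points `p_i = n(ρ i)`. -/
structure Frame where
  ray : Fin n → Δ.Ray
  indep : LinearIndependent ℝ (fun i => latR (Δ.gen (ray i)))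
  cone_mem : PointedCone.hull ℝ (range fun i => latR (Δ.gen (ray i))) ∈ Δ.cones

namespace Frame

variable {Δ}

/-- The cone `σ` generated by the `p_i`. -/
def cone (F : Δ.Frame) : PointedCone ℝ (Fin n → ℝ) :=
  PointedCone.hull ℝ (range fun i => latR (Δ.gen (F.ray i)))

theorem pairing_nonneg (F : Δ.Frame) (m : dualMonoid F.cone) (i : Fin n) :
    0 ≤ (m : Fin n → ℤ) ⬝ᵥ Δ.gen (F.ray i) := by
  have h := m.2 (latR (Δ.gen (F.ray i))) (Submodule.subset_span (mem_range_self i))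
  have h2 : latR (m : Fin n → ℤ) ⬝ᵥ latR (Δ.gen (F.ray i)) =
      (((m : Fin n → ℤ) ⬝ᵥ Δ.gen (F.ray i) : ℤ) : ℝ) := by
    simp [dotProduct, latR]
  rw [h2] at h
  exact_mod_cast h

/-- Let `N' = ℤ{p_1, …, p_n} ⊆ N`, with dual lattice `M' ⊇ M`, and let `σ'` be the cone `σ`
considered in `N'`.  Then `U_{σ'} = ℂⁿ`, with the coordinates given by the basis of `M'` dual to
`p_1, …, p_n`, and the quotient map `U_{σ'} → U_{σ'} / (N / N') = U_σ` sends `z` to the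
homomorphism `m ↦ ∏ i, z_i ^ ⟨m, p_i⟩`. -/
def affineMap (F : Δ.Frame) (z : Fin n → ℂ) : AffinePoint F.cone where
  toFun m := ∏ i, z i ^ ((m.toAdd : Fin n → ℤ) ⬝ᵥ Δ.gen (F.ray i)).toNat
  map_one' := by simp
  map_mul' a b := by
    rw [← Finset.prod_mul_distrib]
    refine Finset.prod_congr rfl fun i _ => ?_
    rw [← pow_add, ← Int.toNat_add (F.pairing_nonneg _ i) (F.pairing_nonneg _ i)]
    simp [add_dotProduct]

end Frame

/-- The uniformizing charts `ℂⁿ = U_{σ'} → U_σ ⊆ X_Δ`, which define the toric orbifold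
`X_{Δ*}`. -/
def chart (F : Δ.Frame) (z : Fin n → ℂ) : Δ.ToricVariety :=
  Quot.mk _ ⟨⟨F.cone, F.cone_mem⟩, F.affineMap z⟩

/-! ### Support functions, the Fano condition, and symmetries -/

/-- `h ∈ SF(Δ*)`: on every cone `σ` of the fan, `h` is a rational linear function `l_σ` that is
integral on the lattice spanned by the points `n(ρ)`, `ρ ⊆ σ`. -/
def IsSupportFunction (h : (Fin n → ℝ) → ℝ) : Prop :=
  ∀ σ ∈ Δ.cones, ∃ l : Fin n → ℚ,
    (∀ s ∈ σ, h s = (fun i => (l i : ℝ)) ⬝ᵥ s) ∧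
    ∀ ρ : Δ.Ray, ρ.1 ≤ σ → ∃ z : ℤ, (fun i => (l i : ℝ)) ⬝ᵥ latR (Δ.gen ρ) = z

/-- Strict upper convexity of a support function `h`: it is superadditive on `N_ℚ`, and it is
given by different linear functions on different `n`-dimensional cones. -/
def IsStrictlyUpperConvex (h : (Fin n → ℝ) → ℝ) : Prop :=
  (∀ x y : Fin n → ℚ,
    h (fun i => (x i : ℝ)) + h (fun i => (y i : ℝ)) ≤ h (fun i => ((x i + y i : ℚ) : ℝ))) ∧
  ∀ σ ∈ Δ.cones, ∀ τ ∈ Δ.cones, coneDim σ = n → coneDim τ = n → σ ≠ τ →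
    ∀ l l' : Fin n → ℝ, (∀ s ∈ σ, h s = l ⬝ᵥ s) → (∀ s ∈ τ, h s = l' ⬝ᵥ s) → l ≠ l'

/-- The toric orbifold is Fano: `-k` is strictly upper convex, where `k ∈ SF(Δ*)` is the support
function of the canonical divisor, with `k (n(ρ)) = 1` for all rays `ρ`. -/
def IsFano : Prop :=
  ∃ k : (Fin n → ℝ) → ℝ, Δ.IsSupportFunction k ∧ (∀ ρ : Δ.Ray, k (latR (Δ.gen ρ)) = 1) ∧
    Δ.IsStrictlyUpperConvex (-k)

end AugmentedFan

/-- The action of `γ ∈ GL(n, ℤ)` on `N_ℝ = ℝⁿ`. -/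
def glR {n : ℕ} (γ : GL (Fin n) ℤ) : (Fin n → ℝ) →ₗ[ℝ] (Fin n → ℝ) :=
  ((γ : Matrix (Fin n) (Fin n) ℤ).map (Int.cast : ℤ → ℝ)).mulVecLin

theorem glR_one {n : ℕ} : glR (1 : GL (Fin n) ℤ) = LinearMap.id := by
  simp [glR, Matrix.map_one]

theorem glR_mul {n : ℕ} (γ δ : GL (Fin n) ℤ) : glR (γ * δ) = (glR γ).comp (glR δ) := by
  rw [glR, glR, glR, ← Matrix.mulVecLin_mul]
  congr 1
  exact Matrix.map_mul (f := Int.castRingHom ℝ)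

theorem map_glR_inv {n : ℕ} (γ : GL (Fin n) ℤ) (σ : PointedCone ℝ (Fin n → ℝ)) :
    (σ.map (glR γ)).map (glR γ⁻¹) = σ := by
  rw [PointedCone.map_map, ← glR_mul, inv_mul_cancel, glR_one, PointedCone.map_id]

theorem map_glR_inv' {n : ℕ} (γ : GL (Fin n) ℤ) (σ : PointedCone ℝ (Fin n → ℝ)) :
    (σ.map (glR γ⁻¹)).map (glR γ) = σ := by
  simpa using map_glR_inv γ⁻¹ σ

theorem coneDim_map_glR {n : ℕ} (γ : GL (Fin n) ℤ) (σ : PointedCone ℝ (Fin n → ℝ)) :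
    coneDim (σ.map (glR γ)) = coneDim σ := by
  have hinj : Function.Injective (glR γ) := by
    have h : Function.LeftInverse (glR γ⁻¹) (glR γ) := fun x => by
      have := LinearMap.congr_fun (glR_mul γ⁻¹ γ) x
      rw [inv_mul_cancel, glR_one] at this
      exact this.symm
    exact h.injective
  have h : Submodule.span ℝ ((σ.map (glR γ) : PointedCone ℝ (Fin n → ℝ)) : Set (Fin n → ℝ)) =
      (Submodule.span ℝ (σ : Set (Fin n → ℝ))).map (glR γ) := by
    rw [Submodule.map_span]
    rfl
  rw [coneDim, coneDim, h]
  exact (LinearEquiv.finrank_eq (Submodule.equivMapOfInjective (glR γ) hinj _)).symm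

/-- The group `W₀(X)` of the symmetries `γ ∈ GL(n, ℤ)` of the augmented fan: `γ` permutes the
cones of the fan and carries `n(ρ)` to `n(γ ρ)` for every ray `ρ`. -/
def AugmentedFan.symmetryGroup {n : ℕ} (Δ : AugmentedFan n) : Subgroup (GL (Fin n) ℤ) where
  carrier := {γ | (∀ σ, σ.map (glR γ) ∈ Δ.cones ↔ σ ∈ Δ.cones) ∧
    ∀ ρ ρ' : Δ.Ray, ρ'.1 = ρ.1.map (glR γ) →
      Δ.gen ρ' = (γ : Matrix (Fin n) (Fin n) ℤ) *ᵥ Δ.gen ρ}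
  one_mem' := by
    refine ⟨fun σ => by rw [glR_one, PointedCone.map_id], fun ρ ρ' h => ?_⟩
    rw [glR_one, PointedCone.map_id] at h
    rw [Subtype.ext h]
    simp
  mul_mem' := by
    rintro γ δ ⟨h1, h2⟩ ⟨h3, h4⟩
    refine ⟨fun σ => ?_, fun ρ ρ' h => ?_⟩
    · rw [glR_mul, ← PointedCone.map_map, h1, h3]
    · rw [glR_mul, ← PointedCone.map_map] at h
      rw [h2 ⟨ρ.1.map (glR δ), (h3 _).2 ρ.2.1, (coneDim_map_glR δ _).trans ρ.2.2⟩ ρ' h,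
        h4 ρ _ rfl]
      simp [Matrix.mulVec_mulVec]
  inv_mem' := by
    rintro γ ⟨h1, h2⟩
    refine ⟨fun σ => ?_, fun ρ ρ' h => ?_⟩
    · rw [← h1, map_glR_inv' γ]
    · have h5 : ρ.1 = ρ'.1.map (glR γ) := by rw [h, map_glR_inv' γ]
      rw [h2 ρ' ρ h5, Matrix.mulVec_mulVec, ← Units.val_mul, inv_mul_cancel]
      simp

/-!
An isomorphism `L^m ≅ K⁻¹` trivializes `L^m` over each chart `ℂⁿ`, by `∂₁ ∧ ⋯ ∧ ∂ₙ`. Local `m`-th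
roots of this trivialization differ by a Čech cocycle of roots of unity, which is a coboundary
because `ℂⁿ` is simply connected; so the trivialization has a global `m`-th root, which trivializes
`L`. In these trivializations of `L`, the lift of a change of charts `e` is a continuous `m`-th
root of `det (De)`.

By the symmetry `-1` there are two `n`-dimensional cones spanned by `p_i` and by `-p_i`. Over the
torus their charts are related by `z ↦ z⁻¹`, whose Jacobian determinant is `(-1)ⁿ ∏ i, z_i⁻²`.
Along a circle in one coordinate it has winding number `-2`, so `m` divides `2`.
-/

section Cech

variable {X ι : Type*} [TopologicalSpace X] {U : ι → Set X}

theorem exists_continuousOn_iUnion_eqOn {Y : Type*} [TopologicalSpace Y] [Nonempty Y]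
    {f : ι → X → Y} (hU : ∀ i, IsOpen (U i)) (hf : ∀ i, ContinuousOn (f i) (U i))
    (hcompat : ∀ i j, EqOn (f i) (f j) (U i ∩ U j)) :
    ∃ F : X → Y, ContinuousOn F (⋃ i, U i) ∧ ∀ i, EqOn F (f i) (U i) := by
  classical
  let F : X → Y := fun x => if hx : ∃ i, x ∈ U i then f hx.choose x else Classical.arbitrary Y
  have hF : ∀ i, EqOn F (f i) (U i) := fun i x hx => by
    have hex : ∃ i, x ∈ U i := ⟨i, hx⟩
    exact (dif_pos hex).trans (hcompat _ _ ⟨hex.choose_spec, hx⟩)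
  exact ⟨F, .iUnion_of_isOpen (fun i => (hf i).congr (hF i)) hU, hF⟩

/-- `c` is a continuous Čech 1-cocycle on the open cover `U` with values in `M`. Only the values
of `c i j` on `U i ∩ U j` are meaningful. -/
structure IsCechCocycle {M : Type*} [TopologicalSpace M] [Mul M] (U : ι → Set X)
    (c : ι → ι → X → M) : Prop where
  isOpen : ∀ i, IsOpen (U i)
  exists_mem : ∀ x, ∃ i, x ∈ U i
  continuousOn : ∀ i j, ContinuousOn (c i j) (U i ∩ U j)
  mul_eq : ∀ i j k, ∀ x ∈ U i ∩ U j ∩ U k, c j k x * c i j x = c i k x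

namespace IsCechCocycle

theorem exists_coboundary_of_discrete [SimplyConnectedSpace X] [LocallyPathConnectedSpace X]
    {G : Type*} [Group G] [TopologicalSpace G] [DiscreteTopology G] {c : ι → ι → X → G}
    (hc : IsCechCocycle U c) :
    ∃ s : ι → X → G, (∀ i, ContinuousOn (s i) (U i)) ∧
      ∀ i j, ∀ x ∈ U i ∩ U j, c i j x * s i x = s j x := by
  choose idx hidx using hc.exists_mem
  have hself : ∀ i, ∀ x ∈ U i, c i i x = 1 := fun i x hx =>
    mul_eq_right.1 (hc.mul_eq i i i x ⟨⟨hx, hx⟩, hx⟩)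
  let Z : FiberBundleCore ι X G :=
    { baseSet := U
      isOpen_baseSet := hc.isOpen
      indexAt := idx
      mem_baseSet_at := hidx
      coordChange := fun i j x v => c i j x * v
      coordChange_self := fun i x hx v => by rw [hself i x hx, one_mul]
      continuousOn_coordChange := fun i j =>
        ((hc.continuousOn i j).comp continuousOn_fst fun p hp => hp.1).mul continuousOn_snd
      coordChange_comp := fun i j k x hx v => by rw [← mul_assoc, hc.mul_eq i j k x hx] }
  obtain ⟨x₀⟩ := (inferInstance : Nonempty X)
  have hcov : IsCoveringMap (Bundle.TotalSpace.proj : Bundle.TotalSpace G Z.Fiber → X) :=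
    FiberBundle.isCoveringMap
  obtain ⟨σ, ⟨-, hσ⟩, -⟩ := hcov.existsUnique_continuousMap_lifts (.id X) x₀ ⟨x₀, (1 : G)⟩ rfl
  have hproj : ∀ x, (σ x).proj = x := fun x => congrFun hσ x
  refine ⟨fun i x => (Z.localTriv i (σ x)).2, fun i => ?_, fun i j x hx => ?_⟩
  · refine continuous_snd.comp_continuousOn
      ((Z.localTriv i).continuousOn.comp σ.continuous.continuousOn fun x hx => ?_)
    rw [Z.mem_localTriv_source]
    exact (hproj x).symm ▸ hx
  · simp only [Z.localTriv_apply, hproj]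
    exact Z.coordChange_comp _ i j x ⟨⟨hidx x, hx.1⟩, hx.2⟩ _

theorem exists_coboundary_of_pow_eq_one [SimplyConnectedSpace X] [LocallyPathConnectedSpace X]
    {c : ι → ι → X → ℂ} (hc : IsCechCocycle U c) {m : ℕ} (hm : m ≠ 0)
    (hpow : ∀ i j, ∀ x ∈ U i ∩ U j, c i j x ^ m = 1) :
    ∃ s : ι → X → ℂ, (∀ i, ContinuousOn (s i) (U i)) ∧ (∀ i x, s i x ^ m = 1) ∧
      ∀ i j, ∀ x ∈ U i ∩ U j, c i j x * s i x = s j x := by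
  classical
  have : NeZero m := ⟨hm⟩
  let root : ℂ → rootsOfUnity m ℂ := fun z =>
    if hz : z ^ m = 1 then rootsOfUnity.mkOfPowEq z hz else 1
  have hroot : ∀ {z : ℂ}, z ^ m = 1 → ((root z : ℂˣ) : ℂ) = z := fun hz => by
    simp only [root, dif_pos hz, rootsOfUnity.val_mkOfPowEq_coe]
  have hval : IsEmbedding fun ζ : rootsOfUnity m ℂ => ((ζ : ℂˣ) : ℂ) :=
    Units.isEmbedding_val₀.comp .subtypeVal
  have hroots : IsCechCocycle U fun i j x => root (c i j x) :=
    { isOpen := hc.isOpen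
      exists_mem := hc.exists_mem
      continuousOn := fun i j =>
        hval.continuousOn_iff.2 ((hc.continuousOn i j).congr fun x hx => hroot (hpow i j x hx))
      mul_eq := fun i j k x hx => hval.injective <| by
        simp only [Subgroup.coe_mul, Units.val_mul, hroot (hpow i j x hx.1),
          hroot (hpow j k x ⟨hx.1.2, hx.2⟩), hroot (hpow i k x ⟨hx.1.1, hx.2⟩),
          hc.mul_eq i j k x hx] }
  obtain ⟨s, hs, hsc⟩ := hroots.exists_coboundary_of_discrete
  refine ⟨fun i x => (s i x : ℂˣ), fun i => hval.continuous.comp_continuousOn (hs i),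
    fun i x => (mem_rootsOfUnity' m _).1 (s i x).2, fun i j x hx => ?_⟩
  simp only [← hsc i j x hx, Subgroup.coe_mul, Units.val_mul, hroot (hpow i j x hx)]

theorem exists_pow_eq_of_forall_pow_mul_pow [SimplyConnectedSpace X]
    [LocallyPathConnectedSpace X] {g : ι → ι → X → ℂ} (hg : IsCechCocycle U g) {m : ℕ}
    (hm : m ≠ 0) {r : ι → X → ℂ} (hr : ∀ i, ContinuousOn (r i) (U i))
    (hr0 : ∀ i, ∀ x ∈ U i, r i x ≠ 0)
    (hrg : ∀ i j, ∀ x ∈ U i ∩ U j, r j x ^ m * g i j x ^ m = r i x ^ m) :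
    ∃ f : ι → X → ℂ, (∀ i, ContinuousOn (f i) (U i)) ∧
      (∀ i, ∀ x ∈ U i, f i x ^ m = r i x ^ m) ∧
      ∀ i j, ∀ x ∈ U i ∩ U j, f j x * g i j x = f i x := by
  have hratio : IsCechCocycle U fun i j x => r j x * g i j x / r i x :=
    { isOpen := hg.isOpen
      exists_mem := hg.exists_mem
      continuousOn := fun i j => (((hr j).mono inter_subset_right).mul (hg.continuousOn i j)).div
        ((hr i).mono inter_subset_left) fun x hx => hr0 i x hx.1
      mul_eq := fun i j k x hx => by
        have hi := hr0 i x hx.1.1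
        have hj := hr0 j x hx.1.2
        rw [← hg.mul_eq i j k x hx]
        field_simp }
  obtain ⟨s, hs, hsm, hsc⟩ := hratio.exists_coboundary_of_pow_eq_one hm fun i j x hx => by
    rw [div_pow, mul_pow, hrg i j x hx, div_self (pow_ne_zero m (hr0 i x hx.1))]
  have hs0 : ∀ i x, s i x ≠ 0 := fun i x h0 => by simpa [h0, hm] using hsm i x
  refine ⟨fun i x => r i x / s i x, fun i => (hr i).div (hs i) fun x _ => hs0 i x,
    fun i x _ => by rw [div_pow, hsm, div_one], fun i j x hx => ?_⟩
  have hi := hr0 i x hx.1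
  have hsi := hs0 i x
  have hsj := hs0 j x
  have hij := hsc i j x hx
  field_simp at hij ⊢
  linear_combination hij

end IsCechCocycle

theorem exists_isOpen_continuousOn_pow_eq {v : X → ℂ} {D : Set X} (hD : IsOpen D)
    (hv : ContinuousOn v D) {x : X} (hx : x ∈ D) (hvx : v x ≠ 0) {m : ℕ} (hm : m ≠ 0) :
    ∃ V ⊆ D, IsOpen V ∧ x ∈ V ∧ ∃ r : X → ℂ, ContinuousOn r V ∧ ∀ y ∈ V, r y ^ m = v y := by
  have hloc := (isCoveringMapOn_npow (𝕜 := ℂ) m (Nat.cast_ne_zero.2 hm)).isLocalHomeomorphOn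
  obtain ⟨w, hw⟩ := IsAlgClosed.exists_pow_nat_eq (v x) (Nat.pos_of_ne_zero hm)
  obtain ⟨e, hwe, he⟩ := hloc w (by simpa [hw] using hvx)
  have he' : ∀ z, e z = z ^ m := fun z => (congrFun he z).symm
  refine ⟨D ∩ v ⁻¹' e.target, inter_subset_left, hv.isOpen_inter_preimage hD e.open_target,
    ⟨hx, ?_⟩, e.symm ∘ v, ?_, fun y hy => ?_⟩
  · rw [mem_preimage, ← hw, ← he']
    exact e.map_source hwe
  · exact e.continuousOn_symm.comp (hv.mono inter_subset_left) fun y hy => hy.2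
  · rw [Function.comp_apply, ← he', e.right_inv hy.2]

/-- Viewing `g` as the transition functions of a line bundle on a simply connected space, every
trivialization `u` of its `m`-th power is the `m`-th power of a trivialization. -/
theorem IsCechCocycle.exists_pow_eq [SimplyConnectedSpace X] [LocallyPathConnectedSpace X]
    {g : ι → ι → X → ℂ} (hg : IsCechCocycle U g) {m : ℕ} (hm : m ≠ 0) {u : ι → X → ℂ}
    (hu : ∀ i, ContinuousOn (u i) (U i)) (hu0 : ∀ i, ∀ x ∈ U i, u i x ≠ 0)
    (hug : ∀ i j, ∀ x ∈ U i ∩ U j, u j x * g i j x ^ m = u i x) :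
    ∃ f : ι → X → ℂ, (∀ i, ContinuousOn (f i) (U i)) ∧
      (∀ i, ∀ x ∈ U i, f i x ^ m = u i x) ∧
      ∀ i j, ∀ x ∈ U i ∩ U j, f j x * g i j x = f i x := by
  choose A hA using hg.exists_mem
  choose V hVU hVo hxV r hr hrm using fun x =>
    exists_isOpen_continuousOn_pow_eq (hg.isOpen (A x)) (hu (A x)) (hA x) (hu0 _ x (hA x)) hm
  have hV : IsCechCocycle V fun p q => g (A p) (A q) :=
    { isOpen := hVo
      exists_mem := fun x => ⟨x, hxV x⟩
      continuousOn := fun p q => (hg.continuousOn _ _).mono (inter_subset_inter (hVU p) (hVU q))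
      mul_eq := fun p q k x hx => hg.mul_eq _ _ _ x ⟨⟨hVU p hx.1.1, hVU q hx.1.2⟩, hVU k hx.2⟩ }
  obtain ⟨f, hf, hfm, hfg⟩ := hV.exists_pow_eq_of_forall_pow_mul_pow hm hr
    (fun p x hx h0 => hu0 _ x (hVU p hx) (by rw [← hrm p x hx, h0, zero_pow hm]))
    (fun p q x hx => by
      rw [hrm q x hx.2, hrm p x hx.1, hug _ _ x ⟨hVU p hx.1, hVU q hx.2⟩])
  have hglue : ∀ i, ∃ F : X → ℂ, ContinuousOn F (U i) ∧
      ∀ p, ∀ x ∈ U i ∩ V p, F x = f p x * g i (A p) x := fun i => by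
    obtain ⟨F, hF, hFf⟩ := exists_continuousOn_iUnion_eqOn (U := fun p => U i ∩ V p)
      (f := fun p x => f p x * g i (A p) x) (fun p => (hg.isOpen i).inter (hVo p))
      (fun p => ((hf p).mono inter_subset_right).mul
        ((hg.continuousOn i (A p)).mono (inter_subset_inter_right _ (hVU p))))
      (fun p q x ⟨⟨hi, hp⟩, ⟨_, hq⟩⟩ => by
        simp only
        rw [← hfg p q x ⟨hp, hq⟩, mul_assoc, hg.mul_eq i _ _ x ⟨⟨hi, hVU p hp⟩, hVU q hq⟩])
    exact ⟨F, hF.mono fun x hx => mem_iUnion.2 ⟨x, hx, hxV x⟩, hFf⟩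
  choose F hF hFf using hglue
  refine ⟨F, hF, fun i x hx => ?_, fun i j x hx => ?_⟩
  · have hx' := hVU x (hxV x)
    rw [hFf i x x ⟨hx, hxV x⟩, mul_pow, hfm x x (hxV x), hrm x x (hxV x), hug _ _ x ⟨hx, hx'⟩]
  · rw [hFf i x x ⟨hx.1, hxV x⟩, hFf j x x ⟨hx.2, hxV x⟩, mul_assoc,
      hg.mul_eq i j _ x ⟨hx, hVU x (hxV x)⟩]

end Cech

theorem dvd_of_continuous_pow_eq_mul_circle_zpow {h : Circle → ℂ} (hcont : Continuous h) {m : ℕ}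
    (hm : m ≠ 0) {c : ℂ} (hc : c ≠ 0) {k : ℤ} (hpow : ∀ t : Circle, h t ^ m = c * (t : ℂ) ^ k) :
    (m : ℤ) ∣ k := by
  have hm' : (m : ℂ) ≠ 0 := Nat.cast_ne_zero.2 hm
  let q : ℝ → ℂ := fun θ => h (Circle.exp θ) * Complex.exp (-(k * (θ * Complex.I)) / m)
  have hqc : Continuous q := by fun_prop
  have hqm : ∀ θ, q θ ^ m = c := fun θ => by
    rw [mul_pow, hpow, ← Complex.exp_nat_mul, mul_div_cancel₀ _ hm', Circle.coe_exp,
      ← Complex.exp_int_mul, mul_assoc, ← Complex.exp_add, add_neg_cancel, Complex.exp_zero,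
      mul_one]
  have hq0 : ∀ θ, q θ ≠ 0 := fun θ h0 => hc (by rw [← hqm θ, h0, zero_pow hm])
  have hperiod : q (2 * Real.pi) = q 0 := congrArg Subtype.val <|
    (isCoveringMap_npow (𝕜 := ℂ) m hm').const_of_comp (g := fun θ => ⟨q θ, hq0 θ⟩)
      (hqc.subtype_mk hq0) (fun θ θ' => Subtype.ext ((hqm θ).trans (hqm θ').symm)) _ _
  have hexp : Complex.exp (-(k * (2 * Real.pi * Complex.I)) / m) = 1 := by
    have h1 : h 1 ≠ 0 := fun h0 => hq0 0 (by simp [q, h0])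
    simpa [q, h1] using hperiod
  obtain ⟨l, hl⟩ := Complex.exp_eq_one_iff.1 hexp
  have hkl : (k : ℂ) = m * -l := by
    field_simp at hl
    linear_combination -hl
  exact ⟨-l, by exact_mod_cast hkl⟩

/-- The identity change of charts: it encodes the changes of trivialization of a V-bundle over a
single chart. -/
noncomputable def ChartChange.refl {n : ℕ} {X ι : Type} (φ : ι → (Fin n → ℂ) → X) (i : ι) :
    ChartChange φ i i where
  toHomeo := OpenPartialHomeomorph.refl _
  holo := analyticOnNhd_id
  holo_symm := analyticOnNhd_id
  proj_eq _ _ := rfl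

namespace LineVBundle

variable {n : ℕ} {X ι : Type} {φ : ι → (Fin n → ℂ) → X} (L : LineVBundle φ)

theorem trans_mul_trans_refl {i j : ι} (e : ChartChange φ i j) {a a' : L.κ i} {b : L.κ j}
    {x : Fin n → ℂ} (ha : x ∈ L.dom i a) (ha' : x ∈ L.dom i a') (hx : x ∈ e.toHomeo.source)
    (hb : e.toHomeo x ∈ L.dom j b) :
    L.trans e a' b x * L.trans (ChartChange.refl φ i) a a' x = L.trans e a b x := by
  refine (L.cocycle (ChartChange.refl φ i) e a a' b x ha (mem_univ x) ha' hx hb).symm.trans ?_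
  exact L.germ _ _ a b x ha ⟨mem_univ x, hx⟩ hx hb .rfl

theorem trans_refl_mul_trans {i j : ι} (e : ChartChange φ i j) {a : L.κ i} {b b' : L.κ j}
    {x : Fin n → ℂ} (ha : x ∈ L.dom i a) (hx : x ∈ e.toHomeo.source)
    (hb : e.toHomeo x ∈ L.dom j b) (hb' : e.toHomeo x ∈ L.dom j b') :
    L.trans (ChartChange.refl φ j) b b' (e.toHomeo x) * L.trans e a b x = L.trans e a b' x := by
  refine (L.cocycle e (ChartChange.refl φ j) a b b' x ha hx hb (mem_univ _) hb').symm.trans ?_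
  exact L.germ _ _ a b' x ha ⟨hx, mem_univ _⟩ hx hb' .rfl

theorem isCechCocycle_trans_refl (i : ι) :
    IsCechCocycle (L.dom i) (L.trans (ChartChange.refl φ i)) where
  isOpen := L.isOpen_dom i
  exists_mem := L.cover i
  continuousOn a b := (L.holo (ChartChange.refl φ i) a b).continuousOn.mono
    fun _ hx => ⟨hx.1, mem_univ _, hx.2⟩
  mul_eq _ _ _ _ hx := L.trans_mul_trans_refl (.refl φ i) hx.1.1 hx.1.2 (mem_univ _) hx.2

theorem exists_trivialization_of_iso_dual_canonical (h : L.Iso (canonical φ).dual) :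
    ∃ u : ∀ i, L.κ i → (Fin n → ℂ) → ℂ, (∀ i a, ContinuousOn (u i a) (L.dom i a)) ∧
      (∀ i a, ∀ x ∈ L.dom i a, u i a x ≠ 0) ∧
      ∀ {i j} (e : ChartChange φ i j) (a : L.κ i) (b : L.κ j), ∀ x ∈ e.toHomeo.source,
        x ∈ L.dom i a → e.toHomeo x ∈ L.dom j b →
          u j b (e.toHomeo x) * L.trans e a b x = (fderiv ℂ e.toHomeo x).det * u i a x := by
  obtain ⟨u, hu, hu0, hue⟩ := h
  refine ⟨fun i a => u i a (), fun i a => (hu i a ()).continuousOn.mono fun x hx => ⟨hx, trivial⟩,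
    fun i a x hx => hu0 i a () x ⟨hx, trivial⟩, fun {i j} e a b x hx ha hb => ?_⟩
  rw [hue i j e a b () () x hx ha trivial hb trivial]
  exact congrArg (· * _) (inv_inv _)

theorem exists_root_trivialization {m : ℕ} (hm : m ≠ 0)
    (h : (L.pow m).Iso (canonical φ).dual) :
    ∃ f : ∀ i, L.κ i → (Fin n → ℂ) → ℂ, (∀ i a, ContinuousOn (f i a) (L.dom i a)) ∧
      (∀ i a, ∀ x ∈ L.dom i a, f i a x ≠ 0) ∧
      (∀ i a b, ∀ x ∈ L.dom i a ∩ L.dom i b,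
        f i b x * L.trans (ChartChange.refl φ i) a b x = f i a x) ∧
      ∀ {i j} (e : ChartChange φ i j) (a : L.κ i) (b : L.κ j), ∀ x ∈ e.toHomeo.source,
        x ∈ L.dom i a → e.toHomeo x ∈ L.dom j b →
          (f j b (e.toHomeo x) * L.trans e a b x) ^ m =
            (fderiv ℂ e.toHomeo x).det * f i a x ^ m := by
  obtain ⟨u, hu, hu0, hue⟩ := (L.pow m).exists_trivialization_of_iso_dual_canonical h
  have hu_refl : ∀ i a b, ∀ x ∈ L.dom i a ∩ L.dom i b,
      u i b x * L.trans (ChartChange.refl φ i) a b x ^ m = u i a x := fun i a b x hx => by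
    refine (hue (.refl φ i) a b x (mem_univ x) hx.1 hx.2).trans ?_
    have hfderiv : fderiv ℂ (ChartChange.refl φ i).toHomeo x = .id ℂ _ := fderiv_id
    rw [hfderiv]
    exact (congrArg (· * u i a x) LinearMap.det_id).trans (one_mul _)
  choose f hf hfm hfg using fun i =>
    (L.isCechCocycle_trans_refl i).exists_pow_eq hm (hu i) (hu0 i) (hu_refl i)
  refine ⟨f, hf, fun i a x hx h0 => hu0 i a x hx ?_, hfg, fun {i j} e a b x hx ha hb => ?_⟩
  · rw [← hfm i a x hx, h0, zero_pow hm]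
  · rw [mul_pow, hfm j b _ hb, hfm i a x ha]
    exact hue e a b x hx ha hb

theorem exists_continuousOn_pow_eq_det_fderiv {m : ℕ} (hm : m ≠ 0)
    (hL : (L.pow m).Iso (canonical φ).dual) {i j : ι} (e : ChartChange φ i j) :
    ∃ h : (Fin n → ℂ) → ℂ, ContinuousOn h e.toHomeo.source ∧
      ∀ x ∈ e.toHomeo.source, h x ^ m = (fderiv ℂ e.toHomeo x).det := by
  obtain ⟨f, hf, hf0, hfg, hfe⟩ := L.exists_root_trivialization hm hL
  let U : L.κ i × L.κ j → Set (Fin n → ℂ) := fun p =>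
    L.dom i p.1 ∩ (e.toHomeo.source ∩ e.toHomeo ⁻¹' L.dom j p.2)
  let H : L.κ i × L.κ j → (Fin n → ℂ) → ℂ := fun p x =>
    f j p.2 (e.toHomeo x) * L.trans e p.1 p.2 x / f i p.1 x
  obtain ⟨h, hh, hhH⟩ := exists_continuousOn_iUnion_eqOn (U := U) (f := H)
    (fun p => (L.isOpen_dom i p.1).inter
      (e.toHomeo.isOpen_inter_preimage (L.isOpen_dom j p.2)))
    (fun p => (((hf j p.2).comp (e.toHomeo.continuousOn.mono fun x hx => hx.2.1)
      fun x hx => hx.2.2).mul (L.holo e p.1 p.2).continuousOn).div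
        ((hf i p.1).mono inter_subset_left) fun x hx => hf0 i p.1 x hx.1)
    (fun ⟨a, b⟩ ⟨a', b'⟩ x ⟨⟨ha, hx, hb⟩, ⟨ha', _, hb'⟩⟩ => by
      simp only [H]
      rw [div_eq_div_iff (hf0 i a x ha) (hf0 i a' x ha'), ← hfg j b b' _ ⟨hb, hb'⟩,
        ← hfg i a a' x ⟨ha, ha'⟩, ← L.trans_mul_trans_refl e ha ha' hx hb,
        ← L.trans_refl_mul_trans e ha' hx hb hb']
      ring)
  have hcover : ∀ x ∈ e.toHomeo.source, ∃ p, x ∈ U p := fun x hx => by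
    obtain ⟨a, ha⟩ := L.cover i x
    obtain ⟨b, hb⟩ := L.cover j (e.toHomeo x)
    exact ⟨(a, b), ha, hx, hb⟩
  refine ⟨h, hh.mono fun x hx => mem_iUnion.2 (hcover x hx), fun x hx => ?_⟩
  obtain ⟨⟨a, b⟩, hp⟩ := hcover x hx
  rw [hhH (a, b) hp, div_pow, hfe e a b x hx hp.1 hp.2.2,
    mul_div_cancel_right₀ _ (pow_ne_zero m (hf0 i a x hp.1))]

theorem one_mem_antiCanonicalRoots (φ : ι → (Fin n → ℂ) → X) : 1 ∈ antiCanonicalRoots φ := by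
  refine ⟨one_pos, (canonical φ).dual, fun _ _ _ _ => 1, fun _ _ _ => analyticOnNhd_const,
    fun _ _ _ _ _ => one_ne_zero, fun i j e a b a' b' x _ _ _ _ _ => ?_⟩
  rw [one_mul, mul_one]
  exact pow_one _

end LineVBundle

section TorusInv

variable (𝕜 ι : Type*)

theorem isOpen_forall_apply_ne_zero [Zero 𝕜] [TopologicalSpace 𝕜] [T1Space 𝕜] [Finite ι] :
    IsOpen {z : ι → 𝕜 | ∀ i, z i ≠ 0} := by
  rw [ofPred_forall]
  exact isOpen_iInter_of_finite fun i => isOpen_ne.preimage (continuous_apply i)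

/-- The inversion `z ↦ z⁻¹` of the torus `(𝕜 ∖ {0})^ι`, coordinate by coordinate. -/
def torusInv [GroupWithZero 𝕜] [TopologicalSpace 𝕜] [ContinuousInv₀ 𝕜] [T1Space 𝕜] [Finite ι] :
    OpenPartialHomeomorph (ι → 𝕜) (ι → 𝕜) where
  toFun z := z⁻¹
  invFun z := z⁻¹
  source := {z | ∀ i, z i ≠ 0}
  target := {z | ∀ i, z i ≠ 0}
  map_source' _ hz i := inv_ne_zero (hz i)
  map_target' _ hz i := inv_ne_zero (hz i)
  left_inv' z _ := inv_inv z
  right_inv' z _ := inv_inv z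
  open_source := isOpen_forall_apply_ne_zero 𝕜 ι
  open_target := isOpen_forall_apply_ne_zero 𝕜 ι
  continuousOn_toFun := continuousOn_pi.2 fun i =>
    (continuous_apply i).continuousOn.inv₀ fun _ hz => hz i
  continuousOn_invFun := continuousOn_pi.2 fun i =>
    (continuous_apply i).continuousOn.inv₀ fun _ hz => hz i

variable [NontriviallyNormedField 𝕜]

theorem analyticOnNhd_torusInv [Fintype ι] :
    AnalyticOnNhd 𝕜 (torusInv 𝕜 ι) (torusInv 𝕜 ι).source := fun z hz =>
  AnalyticAt.pi fun i => ((ContinuousLinearMap.proj i : (ι → 𝕜) →L[𝕜] 𝕜).analyticAt z).inv (hz i)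

variable {𝕜 ι}

theorem hasFDerivAt_torusInv [Finite ι] {z : ι → 𝕜} (hz : ∀ i, z i ≠ 0) :
    HasFDerivAt (torusInv 𝕜 ι)
      (ContinuousLinearMap.pi fun i => (-(z i ^ 2)⁻¹) •
        (ContinuousLinearMap.proj i : (ι → 𝕜) →L[𝕜] 𝕜)) z := by
  have := Fintype.ofFinite ι
  exact hasFDerivAt_pi.2 fun i => (hasDerivAt_inv (hz i)).comp_hasFDerivAt z
    (ContinuousLinearMap.proj i : (ι → 𝕜) →L[𝕜] 𝕜).hasFDerivAt

theorem det_fderiv_torusInv [Fintype ι] {z : ι → 𝕜} (hz : ∀ i, z i ≠ 0) :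
    (fderiv 𝕜 (torusInv 𝕜 ι) z).det = (-1) ^ Fintype.card ι * (∏ i, z i) ^ (-2 : ℤ) := by
  have hdet := LinearMap.det_pi fun i => (-(z i ^ 2)⁻¹) • (LinearMap.id : 𝕜 →ₗ[𝕜] 𝕜)
  rw [(hasFDerivAt_torusInv hz).fderiv]
  refine hdet.trans ?_
  simp [Finset.prod_neg, Finset.prod_pow]

end TorusInv

section Cones

variable {𝕜 E ι : Type*} [Field 𝕜] [LinearOrder 𝕜] [IsStrictOrderedRing 𝕜] [AddCommGroup E]
  [Module 𝕜 E]

theorem mem_hull_range_iff_exists_fun [Fintype ι] {v : ι → E} {y : E} :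
    y ∈ PointedCone.hull 𝕜 (range v) ↔ ∃ c : ι → 𝕜, (∀ i, 0 ≤ c i) ∧ ∑ i, c i • v i = y := by
  rw [PointedCone.hull, Submodule.mem_span_range_iff_exists_fun]
  exact ⟨fun ⟨c, hc⟩ => ⟨fun i => c i, fun i => (c i).2, hc⟩,
    fun ⟨c, hc, hy⟩ => ⟨fun i => ⟨c i, hc i⟩, hy⟩⟩

theorem hull_range_smul_le {c : ι → 𝕜} (hc : ∀ i, 0 ≤ c i) (v : ι → E) :
    PointedCone.hull 𝕜 (range fun i => c i • v i) ≤ PointedCone.hull 𝕜 (range v) :=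
  Submodule.span_le.2 <| range_subset_iff.2 fun i =>
    PointedCone.smul_mem _ (hc i) (PointedCone.subset_hull (mem_range_self i))

theorem hull_range_smul {c : ι → 𝕜} (hc : ∀ i, 0 < c i) (v : ι → E) :
    PointedCone.hull 𝕜 (range fun i => c i • v i) = PointedCone.hull 𝕜 (range v) := by
  refine le_antisymm (hull_range_smul_le (fun i => (hc i).le) v) ?_
  simpa only [inv_smul_smul₀ (hc _).ne'] using
    hull_range_smul_le (fun i => inv_nonneg.2 (hc i).le) fun i => c i • v i

theorem exists_dotProduct_eq_of_linearIndependent {K κ : Type*} [Field K] [Fintype κ]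
    {v : ι → κ → K} (hv : LinearIndependent K v) (w : ι → K) :
    ∃ m : κ → K, ∀ i, m ⬝ᵥ v i = w i := by
  classical
  obtain ⟨ψ, hψ⟩ := ((Module.Basis.span hv).constr K w).exists_extend
  refine ⟨(dotProductEquiv K κ).symm ψ, fun i => ?_⟩
  have hvi := LinearMap.congr_fun hψ (Module.Basis.span hv i)
  rw [Module.Basis.constr_basis, LinearMap.comp_apply, Submodule.subtype_apply,
    Module.Basis.span_apply] at hvi
  rw [← hvi]
  exact LinearMap.congr_fun ((dotProductEquiv K κ).apply_symm_apply ψ) (v i)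

variable {n : ℕ}

theorem isFaceOf_hull_image [Finite ι] {v : ι → Fin n → ℝ} (hv : LinearIndependent ℝ v)
    (s : Set ι) : IsFaceOf (PointedCone.hull ℝ (v '' s)) (PointedCone.hull ℝ (range v)) := by
  classical
  have := Fintype.ofFinite ι
  obtain ⟨m, hm⟩ := exists_dotProduct_eq_of_linearIndependent hv (sᶜ.indicator 1)
  have hm_sum : ∀ c : ι → ℝ, m ⬝ᵥ ∑ i, c i • v i = ∑ i, c i * sᶜ.indicator 1 i := fun c => by
    simp only [dotProduct_sum, dotProduct_smul, hm, smul_eq_mul]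
  have hind : ∀ i, 0 ≤ sᶜ.indicator (1 : ι → ℝ) i := indicator_nonneg fun _ _ => zero_le_one
  refine ⟨m, fun y hy => ?_, fun y => ⟨fun hy => ⟨?_, ?_⟩, fun ⟨hy, hmy⟩ => ?_⟩⟩
  · obtain ⟨c, hc, rfl⟩ := mem_hull_range_iff_exists_fun.1 hy
    rw [hm_sum]
    exact Finset.sum_nonneg fun i _ => mul_nonneg (hc i) (hind i)
  · exact Submodule.span_mono (image_subset_range v s) hy
  · induction hy using Submodule.span_induction with
    | mem x hx =>
      obtain ⟨i, hi, rfl⟩ := hx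
      rw [hm, indicator_of_notMem (notMem_compl_iff.2 hi)]
    | zero => exact dotProduct_zero m
    | add x y _ _ hx hy => rw [dotProduct_add, hx, hy, add_zero]
    | smul c x _ hx => rw [dotProduct_smul, hx, smul_zero]
  · obtain ⟨c, hc, rfl⟩ := mem_hull_range_iff_exists_fun.1 hy
    rw [hm_sum, Finset.sum_eq_zero_iff_of_nonneg fun i _ => mul_nonneg (hc i) (hind i)] at hmy
    refine Submodule.sum_mem _ fun i _ => ?_
    by_cases hi : i ∈ s
    · exact PointedCone.smul_mem _ (hc i) (PointedCone.subset_hull (mem_image_of_mem v hi))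
    · have hci : c i = 0 := by simpa [hi] using hmy i (Finset.mem_univ i)
      rw [hci, zero_smul]
      exact Submodule.zero_mem _

theorem coneDim_hull (s : Set (Fin n → ℝ)) :
    coneDim (PointedCone.hull ℝ s) = Module.finrank ℝ (Submodule.span ℝ s) := by
  rw [coneDim, PointedCone.hull, Submodule.span_span_of_tower]

theorem latR_neg (v : Fin n → ℤ) : latR (-v) = -latR v :=
  funext fun i => Int.cast_neg (v i)

theorem latR_eq_zero {v : Fin n → ℤ} : latR v = 0 ↔ v = 0 := by
  simp [latR, funext_iff]

theorem glR_neg_one : glR (-1 : GL (Fin n) ℤ) = -LinearMap.id := by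
  ext i j
  simp [glR, Matrix.map_neg]

end Cones

namespace AugmentedFan

variable {n : ℕ} {Δ : AugmentedFan n}

theorem IsComplete.exists_coneDim_eq (hΔ : Δ.IsComplete) : ∃ σ ∈ Δ.cones, coneDim σ = n := by
  by_contra! hne
  let spans : Set (Submodule ℝ (Fin n → ℝ)) :=
    (fun σ : PointedCone ℝ (Fin n → ℝ) => Submodule.span ℝ (σ : Set (Fin n → ℝ))) '' Δ.cones
  have hspans : spans.Finite := Δ.finite.image _
  have htop : ⊤ ∉ hspans.toFinset := by
    rw [hspans.mem_toFinset]
    rintro ⟨σ, hσ, hspan⟩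
    refine hne σ hσ ?_
    simp only at hspan
    rw [coneDim, hspan, finrank_top, Module.finrank_fin_fun]
  refine Subspace.biUnion_ne_univ_of_top_notMem htop (eq_univ_of_forall fun x => ?_)
  obtain ⟨σ, hσ, hx⟩ := hΔ x
  exact mem_iUnion₂.2 ⟨_, hspans.mem_toFinset.2 ⟨σ, hσ, rfl⟩, Submodule.subset_span hx⟩

theorem exists_pos_smul_eq_gen {ρ : Δ.Ray} {v : Fin n → ℝ} (hρ : ρ.1 = PointedCone.hull ℝ {v}) :
    ∃ c : ℝ, 0 < c ∧ latR (Δ.gen ρ) = c • v := by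
  obtain ⟨c, hc⟩ := Submodule.mem_span_singleton.1 (hρ ▸ Δ.gen_mem ρ)
  refine ⟨c, lt_of_le_of_ne c.2 fun h0 => Δ.gen_ne_zero ρ (latR_eq_zero.1 ?_), hc.symm⟩
  have hc0 : c = 0 := Subtype.ext h0.symm
  rw [← hc, hc0, zero_smul]

theorem nonempty_frame_of_linearIndependent {v : Fin n → Fin n → ℝ}
    (hv : LinearIndependent ℝ v) (hmem : PointedCone.hull ℝ (range v) ∈ Δ.cones) :
    Nonempty Δ.Frame := by
  have hray : ∀ i, PointedCone.hull ℝ {v i} ∈ Δ.cones ∧ coneDim (PointedCone.hull ℝ {v i}) = 1 :=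
    fun i => ⟨Δ.face_mem _ hmem _ (image_singleton ▸ isFaceOf_hull_image hv {i}),
      by rw [coneDim_hull, finrank_span_singleton (hv.ne_zero i)]⟩
  choose c hc hgen using fun i => exists_pos_smul_eq_gen (Δ := Δ) (ρ := ⟨_, hray i⟩) rfl
  refine ⟨⟨fun i => ⟨_, hray i⟩, ?_, ?_⟩⟩
  · simp only [hgen]
    exact hv.units_smul fun i => Units.mk0 (c i) (hc i).ne'
  · simpa only [hgen, hull_range_smul hc] using hmem

theorem nonempty_frame (hcomplete : Δ.IsComplete) (hsimplicial : Δ.IsSimplicial) :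
    Nonempty Δ.Frame := by
  obtain ⟨σ, hσ, hdim⟩ := hcomplete.exists_coneDim_eq
  obtain ⟨p, hp, rfl⟩ := hsimplicial σ hσ hdim
  exact nonempty_frame_of_linearIndependent hp hσ

namespace Frame

variable {F G : Δ.Frame}

/-- The cones of `F` and `G` are opposite: `G` has the lattice points `-p_i` in place of `p_i`. -/
def IsOpposite (F G : Δ.Frame) : Prop :=
  ∀ i, Δ.gen (G.ray i) = -Δ.gen (F.ray i)

theorem exists_isOpposite (F : Δ.Frame) (hsymm : (-1 : GL (Fin n) ℤ) ∈ Δ.symmetryGroup) :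
    ∃ G : Δ.Frame, F.IsOpposite G := by
  obtain ⟨hcones, hgens⟩ := hsymm
  let ray : Fin n → Δ.Ray := fun i =>
    ⟨(F.ray i).1.map (glR (-1)), (hcones _).2 (F.ray i).2.1,
      (coneDim_map_glR _ _).trans (F.ray i).2.2⟩
  have hgen : ∀ i, Δ.gen (ray i) = -Δ.gen (F.ray i) := fun i => by
    rw [hgens (F.ray i) (ray i) rfl, Units.val_neg, Units.val_one, neg_mulVec, one_mulVec]
  have hlat : (fun i => latR (Δ.gen (ray i))) = glR (-1) ∘ fun i => latR (Δ.gen (F.ray i)) :=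
    funext fun i => by
      rw [hgen, latR_neg, glR_neg_one]
      rfl
  refine ⟨⟨ray, ?_, ?_⟩, hgen⟩
  · rw [hlat]
    refine F.indep.map' (glR (-1)) (LinearMap.ker_eq_bot.2 ?_)
    rw [glR_neg_one]
    exact neg_injective
  · rw [hlat, range_comp]
    convert (hcones _).2 F.cone_mem using 1
    rw [PointedCone.map, PointedCone.hull, PointedCone.hull, Submodule.map_span]
    rfl

/-- The point of the torus of `X_Δ` with coordinates `z ∈ (ℂ ∖ {0})ⁿ` in the chart of `F`, as a
point of `U_σ` for an arbitrary cone `σ`: all the pairings `⟨m, p_i⟩` are allowed as exponents,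
whatever their signs. -/
noncomputable def torusPoint (F : Δ.Frame) (σ : PointedCone ℝ (Fin n → ℝ)) {z : Fin n → ℂ}
    (hz : ∀ i, z i ≠ 0) : AffinePoint σ where
  toFun m := ∏ i, z i ^ ((m.toAdd : Fin n → ℤ) ⬝ᵥ Δ.gen (F.ray i))
  map_one' := by simp
  map_mul' a b := by
    simp [add_dotProduct, zpow_add₀ (hz _), Finset.prod_mul_distrib]

theorem affineMap_eq_torusPoint (F : Δ.Frame) {z : Fin n → ℂ} (hz : ∀ i, z i ≠ 0) :
    F.affineMap z = F.torusPoint F.cone hz := by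
  refine MonoidHom.ext fun m => ?_
  simp only [affineMap, torusPoint, MonoidHom.coe_mk, OneHom.coe_mk]
  refine Finset.prod_congr rfl fun i _ => ?_
  rw [← zpow_natCast, Int.toNat_of_nonneg (F.pairing_nonneg m.toAdd i)]

theorem IsOpposite.torusPoint_inv (h : F.IsOpposite G) (σ : PointedCone ℝ (Fin n → ℝ))
    {z : Fin n → ℂ} (hz : ∀ i, z i ≠ 0) (hz' : ∀ i, z⁻¹ i ≠ 0) :
    G.torusPoint σ hz' = F.torusPoint σ hz := by
  refine MonoidHom.ext fun m => ?_
  simp only [torusPoint, MonoidHom.coe_mk, OneHom.coe_mk]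
  refine Finset.prod_congr rfl fun i _ => ?_
  rw [h i, dotProduct_neg, Pi.inv_apply, _root_.inv_zpow', neg_neg]

theorem IsOpposite.chart_inv (h : F.IsOpposite G) {z : Fin n → ℂ} (hz : ∀ i, z i ≠ 0) :
    Δ.chart G z⁻¹ = Δ.chart F z := by
  have hz' : ∀ i, z⁻¹ i ≠ 0 := fun i => inv_ne_zero (hz i)
  refine (Quot.sound ⟨F.torusPoint _ hz, (F.affineMap_eq_torusPoint hz).symm, ?_⟩).symm
  exact ((G.affineMap_eq_torusPoint hz').trans (h.torusPoint_inv _ hz hz')).symm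

/-- The change of charts `z ↦ z⁻¹` between opposite frames. -/
noncomputable def IsOpposite.chartChange (h : F.IsOpposite G) : ChartChange Δ.chart F G where
  toHomeo := torusInv ℂ (Fin n)
  holo := analyticOnNhd_torusInv ℂ (Fin n)
  holo_symm := analyticOnNhd_torusInv ℂ (Fin n)
  proj_eq _ hz := h.chart_inv hz

theorem IsOpposite.dvd_two_of_mem_antiCanonicalRoots (h : F.IsOpposite G) (hn : 1 ≤ n) {m : ℕ}
    (hm : m ∈ antiCanonicalRoots Δ.chart) : m ∣ 2 := by
  obtain ⟨hm0, L, hL⟩ := hm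
  obtain ⟨r, hr, hrm⟩ := L.exists_continuousOn_pow_eq_det_fderiv hm0.ne' hL h.chartChange
  let circle : Circle → Fin n → ℂ := fun t => Function.update 1 ⟨0, hn⟩ (t : ℂ)
  have hcircle : Continuous circle := continuous_const.update _ continuous_subtype_val
  have hcircle_mem : ∀ t i, circle t i ≠ 0 := fun t i => by
    simp only [circle, Function.update_apply]
    split_ifs
    exacts [Circle.coe_ne_zero t, one_ne_zero]
  have hprod : ∀ t, ∏ i, circle t i = t := fun t => by
    simp only [circle, Finset.prod_update_of_mem (Finset.mem_univ _), Pi.one_apply,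
      Finset.prod_const_one, mul_one]
  have hwind : (m : ℤ) ∣ -2 :=
    dvd_of_continuous_pow_eq_mul_circle_zpow (hr.comp_continuous hcircle hcircle_mem) hm0.ne'
      (pow_ne_zero n (neg_ne_zero.2 one_ne_zero)) fun t => by
        refine (hrm _ (hcircle_mem t)).trans ((det_fderiv_torusInv (hcircle_mem t)).trans ?_)
        rw [Fintype.card_fin, hprod]
  exact_mod_cast (dvd_neg.1 hwind)

end Frame

end AugmentedFan

theorem mainTheorem10_general {n : ℕ} (hn : 1 ≤ n) {Δ : AugmentedFan n} {F G : Δ.Frame}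
    (hFG : F.IsOpposite G) :
    IsGreatest (antiCanonicalRoots Δ.chart) (orbifoldIndex Δ.chart) ∧
      (orbifoldIndex Δ.chart = 1 ∨ orbifoldIndex Δ.chart = 2) := by
  have hdvd : ∀ m ∈ antiCanonicalRoots Δ.chart, m ∣ 2 := fun m hm =>
    hFG.dvd_two_of_mem_antiCanonicalRoots hn hm
  have hbdd : BddAbove (antiCanonicalRoots Δ.chart) :=
    ⟨2, fun m hm => Nat.le_of_dvd two_pos (hdvd m hm)⟩
  have hmem : orbifoldIndex Δ.chart ∈ antiCanonicalRoots Δ.chart :=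
    Nat.sSup_mem ⟨1, LineVBundle.one_mem_antiCanonicalRoots Δ.chart⟩ hbdd
  exact ⟨⟨hmem, fun m hm => le_csSup hbdd hm⟩, (Nat.dvd_prime Nat.prime_two).1 (hdvd _ hmem)⟩

theorem mainTheorem10 {n : ℕ} (hn : 1 ≤ n) (Δ : AugmentedFan n)
    (hcomplete : Δ.IsComplete) (hsimplicial : Δ.IsSimplicial) (hFano : Δ.IsFano)
    (hsymm : (-1 : GL (Fin n) ℤ) ∈ Δ.symmetryGroup) :
    IsGreatest (antiCanonicalRoots Δ.chart) (orbifoldIndex Δ.chart) ∧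
      (orbifoldIndex Δ.chart = 1 ∨ orbifoldIndex Δ.chart = 2) := by
  obtain ⟨F⟩ := AugmentedFan.nonempty_frame hcomplete hsimplicial
  obtain ⟨G, hFG⟩ := F.exists_isOpposite hsymm
  exact mainTheorem10_general hn hFG
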